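/- **Setting.** Let $\mathcal X$ be a real Hilbert space. A lower triangular matrix $H=(h_{k,j})\in\mathbb R^{n\times n}$ (an H-matrix) defines, for an operator $T:\mathcal X\to\mathcal X$ and a starting point $y_0\in\mathcal X$, the algorithm $$y_{k+1}=y_k-\sum_{j=0}^{k}h_{k+1,j+1}\,(y_j-Ty_j),\qquad k=0,\dots,n-1.$$ Let $\mathcal H_\star(n)$ be the set of lower triangular $H\in\mathbb R^{n\times n}$ such that $\|y_n-Ty_n\|^2\le \frac{4\|y_0-y_\star\|^2}{(n+1)^2}$ for every nonexpansive operator $T$ on a real Hilbert space, every fixed point $y_\star$ of $T$ and every $y_0$. For $m\geq 1$ put $$Q(m,j;H)=\sum_{j=j(1)\le i(1)<j(2)\le i(2)<\cdots<j(m)\le i(m)\le n}\ \prod_{r=1}^m h_{i(r),j(r)} .$$ *Dual-OHM.* $H_{\text{Dual-OHM}}(N-1)\in\mathbb R^{(N-1)\times(N-1)}$ has entries $-\frac{N-k}{(N-j)(N-j+1)}$ for $j<k$, $\frac{N-k}{N-k+1}$ for $j=k$, and $0$ for $j>k$. *Gluing.* For $1\le N'\le N-1$, $H_1\in\mathcal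 H_\star(N'-1)$ and $H_2\in\mathcal H_\star(N-N'-1)$, a gluing $H_1\bowtie H_2$ is a lower triangular $H=(h_{k,j})\in\mathbb R^{(N-1)\times(N-1)}$ whose upper left $(N'-1)\times(N'-1)$ block is $H_1$, whose lower right $(N-N'-1)\times(N-N'-1)$ block is $H_2$, whose lower left $(N-N'-1)\times(N'-1)$ block is $0$, with $h_{N',j}=-\frac{N-N'}{N}\sum_{k=j}^{N'-1}(H_1)_{k,j}$ for $1\le j\le N'-1$, $h_{N',N'}=\frac{N'(N-N')}{N}$, and with the rest of column $N'$ determined by $Q(k,N';H)=\frac{N'(N-N'+1)}{N(k+1)}\binom{N-N'-1}{k-1}$ for $k=1,\dots,N-N'$. Empty ($0\times0$) matrices are allowed. *Repeated Dual-OHM (RDO).* Let $p\ge1$ be an integer. The H-matrices of RDO with period $p$ are $H^{(0)}=[\,\,]$ and $H^{(n+1)}=H^{(n)}\bowtie H_{\text{Dual-OHM}}(p-1)\in\mathbb R^{(n+1)p\times(n+1)p}$, and RDO with period $p$ is the algorithm whose first $np$ iterations are given by $H^{(n)}$, for every $n$. **Proposition.** Let $p\ge1$ be an integer. 1. There is exactly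 one sequence $(H^{(n)})_{n\ge0}$ as above; $H^{(n)}\in\mathcal H_\star(np)$ for all $n$, and $H^{(m)}$ is the upper left $mp\times mp$ submatrix of $H^{(n)}$ whenever $m<n$. Hence for every $T:\mathcal X\to\mathcal X$ and every $y_0\in\mathcal X$, RDO with period $p$ produces exactly one sequence $(y_n)_{n\ge0}$. 2. For every $T:\mathcal X\to\mathcal X$, a sequence $(y_n)_{n\ge 0}$ in $\mathcal X$ is produced by RDO with period $p$ if and only if for all $k=0,1,2,\dots$ $$y_{kp+\ell+1}=\begin{cases} y_{kp}-\frac{p(kp+1)}{(k+1)p+1}(y_{kp}-Ty_{kp})+\frac{p}{(k+1)p+1}(y_0-y_{kp}) & \ell=0,\\[2pt] y_{kp+1}+\frac{p-1}{p}\Bigl(Ty_{kp+1}-y_{kp+1}+\frac{kp+1}{(k+1)p+1}(y_{kp}-Ty_{kp})\Bigr) & \ell=1,\ p\ge2,\\[2pt] y_{kp+\ell}+\frac{p-\ell}{p-\ell+1}\,(Ty_{kp+\ell}-Ty_{kp+\ell-1}) & 2\le\ell\le p-1.\end{cases}$$ 3. This recurrence can be run by keeping, besides the current iterate, only $y_0$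 and one past vector $w$ in memory: at step $n=kp+\ell$ ($0\le\ell\le p-1$), evaluate $Ty_n$, compute $y_{n+1}$ by the formula above with $w$ in the place of $y_{kp}-Ty_{kp}$ if $\ell=1$ and of $Ty_{kp+\ell-1}$ if $\ell\ge2$, and then overwrite $w$ by $y_n-Ty_n$ if $\ell=0$ and by $Ty_n$ if $\ell\ge1$. The iterates so computed are those of RDO. 4. If $T$ is nonexpansive and $y_\star$ is a fixed point of $T$, then the iterates of RDO with period $p$ satisfy $$\|y_{kp}-Ty_{kp}\|^2\le\frac{4\|y_0-y_\star\|^2}{(kp+1)^2}\qquad\text{for all }k=0,1,2,\dots$$ -/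

import Mathlib

universe u

/-- An H-matrix with `n` rows: row `k` holds the step sizes of the `k`-th update. -/
abbrev HMatrix (n : ℕ) : Type := Matrix (Fin n) (Fin n) ℝ

/-- The entry `h_{k,j}` in the 1-indexed convention (zero outside `1 ≤ k, j ≤ n`). -/
def HMatrix.entry {n : ℕ} (H : HMatrix n) (k j : ℕ) : ℝ :=
  if h : (1 ≤ k ∧ k ≤ n) ∧ (1 ≤ j ∧ j ≤ n) then
    H ⟨k - 1, by omega⟩ ⟨j - 1, by omega⟩
  else 0

/-- `T` is nonexpansive. -/
def Nonexpansive {X : Type*} [NormedAddCommGroup X] (T : X → X) : Prop :=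
  ∀ x y : X, ‖T x - T y‖ ≤ ‖x - y‖

/-- The first `n` updates of the sequence `y` are those of the algorithm with H-matrix `H`:
`y_{k+1} = y_k - ∑_{j=0}^{k} h_{k+1,j+1} (y_j - T y_j)` for `k = 0, …, n-1`. -/
def RunsHMatrix {X : Type*} [NormedAddCommGroup X] [InnerProductSpace ℝ X]
    {n : ℕ} (H : HMatrix n) (T : X → X) (y : ℕ → X) : Prop :=
  ∀ k < n, y (k + 1) =
    y k - ∑ j ∈ Finset.range (k + 1), H.entry (k + 1) (j + 1) • (y j - T (y j))

/-- The set of optimal H-matrices with `n` rows (`n = N - 1`): lower triangular, and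
`‖y_n - T y_n‖² ≤ 4 ‖y_0 - y⋆‖² / (n + 1)²` for every nonexpansive operator on a real Hilbert
space and each of its fixed points `y⋆`. -/
def OptimalHMatrices (n : ℕ) : Set (HMatrix n) :=
  {H | (∀ i j : Fin n, i < j → H i j = 0) ∧
    ∀ (X : Type u) [NormedAddCommGroup X] [InnerProductSpace ℝ X] [CompleteSpace X]
      (T : X → X) (y : ℕ → X) (ystar : X),
      Nonexpansive T → T ystar = ystar → RunsHMatrix H T y →
        ‖y n - T (y n)‖ ^ 2 ≤ 4 * ‖y 0 - ystar‖ ^ 2 / ((n : ℝ) + 1) ^ 2}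

/-- The Q-function `Q(m, j; H)`: the sum of `∏_{r=1}^m h_{i(r),j(r)}` over all index chains
`j = j(1) ≤ i(1) < j(2) ≤ i(2) < ⋯ < j(m) ≤ i(m) ≤ n`, organised by the first pair
`(i(1), j(2))`. It is only used for `m ≥ 1`. -/
def HMatrix.Q {n : ℕ} (H : HMatrix n) : ℕ → ℕ → ℝ
  | 0, _ => 0
  | 1, j => ∑ i ∈ Finset.Icc j n, H.entry i j
  | m + 2, j => ∑ i ∈ Finset.Icc j n, H.entry i j *
      ∑ j' ∈ Finset.Icc (i + 1) n, H.Q (m + 1) j'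

/-- The H-matrix of Dual-OHM with `n` updates (`N = n + 1`). -/
noncomputable def dualOHM (n : ℕ) : HMatrix n :=
  Matrix.of fun a b =>
    let N : ℝ := (n : ℝ) + 1
    let k : ℝ := (a : ℕ) + 1
    let j : ℝ := (b : ℕ) + 1
    if b < a then -((N - k) / ((N - j) * (N - j + 1)))
    else if b = a then (N - k) / (N - k + 1)
    else 0

/-- `H` is the gluing `H₁ ⋈ H₂` of the optimal H-matrices `H₁` (`N' - 1` rows) and
`H₂` (`N - N' - 1` rows); here `N' = a + 1` and `N = n + 1`, so that `N - N' = b + 1`. -/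
structure IsGluing {a b n : ℕ} (H₁ : HMatrix a) (H₂ : HMatrix b) (H : HMatrix n) : Prop where
  optimal_left : H₁ ∈ OptimalHMatrices.{u} a
  optimal_right : H₂ ∈ OptimalHMatrices.{u} b
  size : n = a + 1 + b
  /-- everything above the diagonal vanishes -/
  lower : ∀ i j : Fin n, i < j → H i j = 0
  /-- upper left block -/
  left_block : ∀ k ∈ Finset.Icc 1 a, ∀ j ∈ Finset.Icc 1 a, H.entry k j = H₁.entry k j
  /-- lower right block -/
  right_block : ∀ k ∈ Finset.Icc 1 b, ∀ j ∈ Finset.Icc 1 b,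
    H.entry (a + 1 + k) (a + 1 + j) = H₂.entry k j
  /-- lower left block -/
  zero_block : ∀ k ∈ Finset.Icc 1 b, ∀ j ∈ Finset.Icc 1 a, H.entry (a + 1 + k) j = 0
  /-- `h_{N',j} = -((N - N') / N) ∑_{k=j}^{N'-1} (H₁)_{k,j}` for `1 ≤ j ≤ N' - 1` -/
  row : ∀ j ∈ Finset.Icc 1 a, H.entry (a + 1) j =
    -(((b : ℝ) + 1) / ((n : ℝ) + 1)) * ∑ k ∈ Finset.Icc j a, H₁.entry k j
  /-- `h_{N',N'} = N' (N - N') / N` -/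
  corner : H.entry (a + 1) (a + 1) = ((a : ℝ) + 1) * ((b : ℝ) + 1) / ((n : ℝ) + 1)
  /-- the rest of column `N'` is determined by
  `Q(k, N'; H) = N' (N - N' + 1) / (N (k + 1)) * C(N - N' - 1, k - 1)`, `1 ≤ k ≤ N - N'` -/
  column : ∀ k ∈ Finset.Icc 1 (b + 1), H.Q k (a + 1) =
    ((a : ℝ) + 1) * ((b : ℝ) + 2) / (((n : ℝ) + 1) * ((k : ℝ) + 1)) * (b.choose (k - 1) : ℝ)

/-- `H n` (with `n * p` rows) are the H-matrices of Repeated Dual-OHM with period `p`: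
`H 0` is the empty matrix, and `H (n + 1) = H n ⋈ H_{Dual-OHM}(p - 1)`. -/
def IsRDOFamily (p : ℕ) (H : (n : ℕ) → HMatrix (n * p)) : Prop :=
  ∀ n, IsGluing.{u} (H n) (dualOHM (p - 1)) (H (n + 1))

/-- The three-case recurrence of Repeated Dual-OHM with period `p`. -/
def RDORecurrence {X : Type*} [NormedAddCommGroup X] [InnerProductSpace ℝ X]
    (p : ℕ) (T : X → X) (y : ℕ → X) : Prop :=
  ∀ k : ℕ,
    (y (k * p + 1) = y (k * p)
        - ((p : ℝ) * (k * p + 1) / ((k + 1) * p + 1)) • (y (k * p) - T (y (k * p)))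
        + ((p : ℝ) / ((k + 1) * p + 1)) • (y 0 - y (k * p))) ∧
    (2 ≤ p → y (k * p + 2) = y (k * p + 1)
        + (((p : ℝ) - 1) / p) • (T (y (k * p + 1)) - y (k * p + 1)
          + (((k : ℝ) * p + 1) / ((k + 1) * p + 1)) • (y (k * p) - T (y (k * p))))) ∧
    (∀ l : ℕ, 2 ≤ l → l ≤ p - 1 → y (k * p + l + 1) = y (k * p + l)
        + (((p : ℝ) - l) / ((p : ℝ) - l + 1)) •
          (T (y (k * p + l)) - T (y (k * p + l - 1))))

/-- The recurrence run in low memory. Between two updates, the state consists of the current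
iterate and one past vector (besides the fixed `y0`); the `n`-th update (`n = k p + l`) evaluates
`T` at the current iterate only and stores a new past vector, `y_{kp} - T y_{kp}` if `l = 0` and
`T y_n` if `l ≥ 1`. -/
noncomputable def rdoLowMemory {X : Type*} [NormedAddCommGroup X] [InnerProductSpace ℝ X]
    (p : ℕ) (T : X → X) (y0 : X) : ℕ → X × X
  | 0 => (y0, 0)
  | n + 1 =>
    let y := (rdoLowMemory p T y0 n).1
    let w := (rdoLowMemory p T y0 n).2
    let Ty := T y
    let k : ℝ := (n / p : ℕ)
    let l : ℕ := n % p
    if l = 0 then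
      (y - ((p : ℝ) * (k * p + 1) / ((k + 1) * p + 1)) • (y - Ty)
        + ((p : ℝ) / ((k + 1) * p + 1)) • (y0 - y), y - Ty)
    else if l = 1 then
      (y + (((p : ℝ) - 1) / p) • (Ty - y + ((k * p + 1) / ((k + 1) * p + 1)) • w), Ty)
    else
      (y + (((p : ℝ) - l) / ((p : ℝ) - l + 1)) • (Ty - w), Ty)

/-!
The proof rests on closed forms for the H-matrices and on a direct certificate for the rate.

*The matrices.* Counted from the last row, the entries of Dual-OHM do not depend on its size
(`dualCoeff`), and one binomial identity (`sum_dualCoeff_mul_choose`) gives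
`Q(m + 1, j) = C(b - j, m) / (m + 2)` for Dual-OHM with `b` rows (`dualOHM_Q`). Hence the conditions
on column `N'` of a gluing with Dual-OHM prescribe the binomial sums `∑ e_t C(t, m)` of its entries.
The matrix `(C(t, m))` is triangular with unit diagonal, so there is at most one such column, and
the same identity shows that a multiple of the first column of the next larger Dual-OHM matrix
works (`isGluing_glueDual`, `IsGluing.eq_glueDual`).

*The recurrence.* In row `N'` the column sums of `H₁` telescope to `y 0 - y a`, where `a = N' - 1`.
In the rows below, consecutive entries of all earlier columns have the same ratio, so each update is
a multiple of the previous one plus two terms. This is `RunsHMatrix.blockStep`. The recurrence has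
only one solution with a given starting point, and the algorithm has one, so the two are equivalent.

*The rate.* Write `g_l` and `u_l` for the residual and the iterate after `l` updates of a block of
length `p = b + 1` that starts at time `a`. The invariant is
`a / 2 * ‖g_0‖ ^ 2 + ⟪g_0, u_0 - y 0⟫ ≤ 0` (`AnchorInequality`), and its value at time `a + p` is
`(a + 1) / (a + p + 1)` times its value at time `a`, plus a combination with nonnegative weights of
`‖g_l - g_p‖ ^ 2 / 2 - ⟪g_l - g_p, u_l - u_p⟫ ≤ 0` for `l < p`. For `l ≥ 1` the weights are
`(a + p + 1) / ((p - l) (p - l + 1))`, and the sum telescopes (`telescope_identity`,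
`BlockStep.potential_nonneg`). Since Dual-OHM is a single block that starts from the empty matrix
(`glueDual_empty`), the same certificate proves its optimality, and hence that all gluings involved
are gluings of optimal matrices.
-/

/-! ### Binomial sums of the Dual-OHM coefficients -/

/-- The step sizes of Dual-OHM with both indices counted from the end,
`h_{k,j} = dualCoeff (N - j) (N - k)`; in this form they do not depend on the number of rows.
Above the diagonal, where `t > r`, the value is `0`. -/
noncomputable def dualCoeff (r t : ℕ) : ℝ :=
  if t < r then -((t : ℝ) / (r * (r + 1))) else if t = r then (r : ℝ) / (r + 1) else 0

theorem dualCoeff_self (r : ℕ) : dualCoeff r r = (r : ℝ) / (r + 1) := by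
  simp [dualCoeff]

theorem dualCoeff_of_lt {r t : ℕ} (h : t < r) :
    dualCoeff r t = -((t : ℝ) / (r * (r + 1))) := by
  simp [dualCoeff, h]

theorem dualCoeff_of_gt {r t : ℕ} (h : r < t) : dualCoeff r t = 0 := by
  simp [dualCoeff, h.not_gt, h.ne']

theorem sub_mul_choose_succ (r m : ℕ) :
    ((r : ℝ) + 1 - m) * ((r + 1).choose m : ℝ) = ((r : ℝ) + 1) * (r.choose m : ℝ) := by
  rcases le_or_gt m (r + 1) with h | h
  · have := Nat.choose_mul_succ_eq r m
    have h2 : ((r.choose m * (r + 1) : ℕ) : ℝ) = (((r + 1).choose m * (r + 1 - m) : ℕ) : ℝ) := by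
      rw [this]
    push_cast [Nat.cast_sub h] at h2
    linarith
  · rw [Nat.choose_eq_zero_of_lt h, Nat.choose_eq_zero_of_lt (by omega)]
    simp

theorem sum_range_succ_mul_choose (r m : ℕ) :
    ((m : ℝ) + 2) * ∑ t ∈ Finset.range r, ((t : ℝ) + 1) * (t.choose m : ℝ) =
      ((r : ℝ) + 1) * ((r : ℝ) - m) * (r.choose m : ℝ) := by
  induction r with
  | zero =>
    rcases m with _ | m <;> simp
  | succ r ih =>
    rw [Finset.sum_range_succ, mul_add, ih]
    have := sub_mul_choose_succ r m
    push_cast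
    linear_combination (-(r : ℝ) - 2) * this

theorem sum_range_choose_cast (r m : ℕ) :
    ∑ t ∈ Finset.range r, (t.choose m : ℝ) = (r.choose (m + 1) : ℝ) := by
  induction r with
  | zero => simp
  | succ r ih =>
    rw [Finset.sum_range_succ, ih, Nat.choose_succ_succ]
    push_cast
    ring

/-- The identity behind both the values of `Q` for Dual-OHM and the glued column. -/
theorem sum_dualCoeff_mul_choose (r m : ℕ) :
    ∑ t ∈ Finset.range (r + 1), dualCoeff (r + 1) (t + 1) * (t.choose m : ℝ) =
      ((m : ℝ) + 1) / (m + 2) * (r.choose m : ℝ) := by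
  have h1 : ∑ t ∈ Finset.range r, dualCoeff (r + 1) (t + 1) * (t.choose m : ℝ) =
      -(1 / (((r : ℝ) + 1) * (r + 2))) *
        ∑ t ∈ Finset.range r, ((t : ℝ) + 1) * (t.choose m : ℝ) := by
    rw [Finset.mul_sum]
    refine Finset.sum_congr rfl fun t ht => ?_
    rw [dualCoeff_of_lt (by simpa using ht)]
    push_cast
    rw [show (r : ℝ) + 1 + 1 = r + 2 by ring]
    ring
  have h2 : ∑ t ∈ Finset.range r, ((t : ℝ) + 1) * (t.choose m : ℝ) =
      ((r : ℝ) + 1) * ((r : ℝ) - m) * (r.choose m : ℝ) / (m + 2) := by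
    rw [eq_div_iff (by positivity), ← sum_range_succ_mul_choose]
    ring
  rw [Finset.sum_range_succ, h1, h2, dualCoeff_self]
  push_cast
  field_simp
  ring

theorem sum_Icc_sub_eq_sum_range {M : Type*} [AddCommMonoid M] (f : ℕ → M) {j b : ℕ}
    (h : j ≤ b + 1) :
    ∑ i ∈ Finset.Icc j b, f (b - i) = ∑ t ∈ Finset.range (b + 1 - j), f t := by
  refine Finset.sum_nbij' (fun i => b - i) (fun t => b - t) ?_ ?_ ?_ ?_ ?_ <;>
    simp only [Finset.mem_Icc, Finset.mem_range] <;> intros <;> first | omega | trivial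

theorem sum_Icc_add_eq {M : Type*} [AddCommMonoid M] (f : ℕ → M) (c j b : ℕ) :
    ∑ i ∈ Finset.Icc (c + j) (c + b), f i = ∑ i ∈ Finset.Icc j b, f (c + i) := by
  rw [← Finset.map_add_left_Icc, Finset.sum_map]
  rfl

/-- The matrix `(C(t, m))` is triangular with unit diagonal, so the binomial sums determine the
coefficients. -/
theorem eq_of_sum_mul_choose_eq {b : ℕ} {e e' : ℕ → ℝ}
    (h : ∀ m ≤ b, ∑ t ∈ Finset.range (b + 1), e t * (t.choose m : ℝ) =
      ∑ t ∈ Finset.range (b + 1), e' t * (t.choose m : ℝ)) :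
    ∀ t ≤ b, e t = e' t := by
  have key : ∀ d, ∀ t ≤ b, b - t = d → e t = e' t := by
    intro d
    induction d using Nat.strong_induction_on with
    | _ d ih =>
      intro t ht hd
      have h0 : ∑ s ∈ Finset.range (b + 1), (e s - e' s) * (s.choose t : ℝ) = 0 := by
        simp only [sub_mul, Finset.sum_sub_distrib, h t ht, sub_self]
      rw [Finset.sum_eq_single t] at h0
      · simpa [sub_eq_zero] using h0
      · intro s hs hst
        rw [Finset.mem_range] at hs
        rcases lt_or_gt_of_ne hst with hlt | hgt
        · simp [Nat.choose_eq_zero_of_lt hlt]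
        · rw [ih (b - s) (by omega) s (by omega) rfl]
          simp
      · intro hn
        exact absurd (Finset.mem_range.2 (by omega)) hn
  exact fun t ht => key _ t ht rfl

/-! ### Entries of H-matrices and the Q-function of Dual-OHM -/

theorem HMatrix.entry_eq_zero_of_lt {n : ℕ} {H : HMatrix n}
    (hH : ∀ i j : Fin n, i < j → H i j = 0) {k j : ℕ} (hk : 1 ≤ k) (h : k < j) :
    H.entry k j = 0 := by
  unfold HMatrix.entry
  split_ifs with hc
  · exact hH _ _ (by simp only [Fin.lt_def]; omega)
  · rfl

theorem HMatrix.entry_of {n : ℕ} (f : ℕ → ℕ → ℝ) {k j : ℕ} (hk : 1 ≤ k) (hk' : k ≤ n)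
    (hj : 1 ≤ j) (hj' : j ≤ n) :
    HMatrix.entry (n := n) (Matrix.of fun i j : Fin n => f (i + 1) (j + 1)) k j = f k j := by
  unfold HMatrix.entry
  rw [dif_pos ⟨⟨hk, hk'⟩, hj, hj'⟩]
  simp [Nat.sub_add_cancel hk, Nat.sub_add_cancel hj]

theorem HMatrix.ext_entry {n : ℕ} {H H' : HMatrix n}
    (h : ∀ k j, 1 ≤ k → k ≤ n → 1 ≤ j → j ≤ n → H.entry k j = H'.entry k j) : H = H' := by
  ext i j
  have := h (i + 1) (j + 1) (by omega) (by omega) (by omega) (by omega)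
  unfold HMatrix.entry at this
  rw [dif_pos (by omega), dif_pos (by omega)] at this
  simpa using this

theorem dualOHM_eq_of (b : ℕ) :
    dualOHM b = Matrix.of fun i j : Fin b => dualCoeff (b + 1 - (j + 1)) (b + 1 - (i + 1)) := by
  ext i j
  have hi : ((b + 1 - ((i : ℕ) + 1) : ℕ) : ℝ) = (b : ℝ) + 1 - ((i : ℕ) + 1) := by
    rw [Nat.cast_sub (by omega)]; push_cast; ring
  have hj : ((b + 1 - ((j : ℕ) + 1) : ℕ) : ℝ) = (b : ℝ) + 1 - ((j : ℕ) + 1) := by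
    rw [Nat.cast_sub (by omega)]; push_cast; ring
  simp only [dualOHM, Matrix.of_apply, Fin.lt_def]
  rcases lt_trichotomy (j : ℕ) (i : ℕ) with h | h | h
  · rw [if_pos h, dualCoeff_of_lt (by omega), hi, hj]
  · have h' : j = i := Fin.ext h
    subst h'
    simp only [lt_irrefl, if_false, if_true]
    rw [dualCoeff_self, hi]
  · rw [if_neg (by omega), if_neg (by intro h'; subst h'; omega), dualCoeff_of_gt (by omega)]

theorem dualOHM_entry {b k j : ℕ} (hk : 1 ≤ k) (hk' : k ≤ b) (hj : 1 ≤ j) (hj' : j ≤ b) :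
    (dualOHM b).entry k j = dualCoeff (b + 1 - j) (b + 1 - k) := by
  rw [dualOHM_eq_of]
  exact HMatrix.entry_of (fun k j => dualCoeff (b + 1 - j) (b + 1 - k)) hk hk' hj hj'

theorem sum_dualOHM_entry_mul_choose {b j : ℕ} (m : ℕ) (hj : 1 ≤ j) (hj' : j ≤ b) :
    ∑ i ∈ Finset.Icc j b, (dualOHM b).entry i j * ((b - i).choose m : ℝ) =
      ((m : ℝ) + 1) / (m + 2) * ((b - j).choose m : ℝ) := by
  rw [← sum_dualCoeff_mul_choose, show b - j + 1 = b + 1 - j by omega,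
    ← sum_Icc_sub_eq_sum_range _ (by omega)]
  refine Finset.sum_congr rfl fun i hi => ?_
  rw [Finset.mem_Icc] at hi
  rw [dualOHM_entry (by omega) hi.2 hj hj', show b - i + 1 = b + 1 - i by omega]

theorem sum_Icc_choose_sub {b i : ℕ} (m : ℕ) (hi : i ≤ b) :
    ∑ j ∈ Finset.Icc (i + 1) b, ((b - j).choose m : ℝ) = ((b - i).choose (m + 1) : ℝ) := by
  rw [sum_Icc_sub_eq_sum_range (fun t => (t.choose m : ℝ)) (by omega), sum_range_choose_cast,
    Nat.add_sub_add_right]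

theorem dualOHM_Q {b : ℕ} (m : ℕ) :
    ∀ j, 1 ≤ j → j ≤ b → (dualOHM b).Q (m + 1) j = ((b - j).choose m : ℝ) / (m + 2) := by
  induction m with
  | zero =>
    intro j hj hj'
    have := sum_dualOHM_entry_mul_choose 0 hj hj'
    simp only [Nat.choose_zero_right, Nat.cast_one, mul_one] at this
    simp only [HMatrix.Q, this]
    norm_num
  | succ m ih =>
    intro j hj hj'
    have h1 : (dualOHM b).Q (m + 1 + 1) j =
        ∑ i ∈ Finset.Icc j b, (dualOHM b).entry i j * ((b - i).choose (m + 1) : ℝ) / (m + 2) := by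
      simp only [HMatrix.Q]
      refine Finset.sum_congr rfl fun i hi => ?_
      rw [Finset.mem_Icc] at hi
      rw [mul_div_assoc, ← sum_Icc_choose_sub m hi.2, Finset.sum_div]
      congr 1
      refine Finset.sum_congr rfl fun j' hj' => ?_
      rw [Finset.mem_Icc] at hj'
      rw [ih j' (by omega) hj'.2]
    rw [h1, ← Finset.sum_div, sum_dualOHM_entry_mul_choose (m + 1) hj hj']
    push_cast
    field_simp
    ring

/-! ### Gluing with Dual-OHM -/

/-- The entries (1-indexed) of the gluing of `H₁` with the Dual-OHM matrix with `b` rows, in closed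
form: column `a + 1` is a multiple of the first column of the Dual-OHM matrix with `b + 1` rows. -/
noncomputable def glueEntry {a : ℕ} (H₁ : HMatrix a) (b k j : ℕ) : ℝ :=
  if j ≤ a then
    if k ≤ a then H₁.entry k j
    else if k = a + 1 then
      -(((b : ℝ) + 1) / ((a : ℝ) + b + 2)) * ∑ i ∈ Finset.Icc j a, H₁.entry i j
    else 0
  else if j = a + 1 then
    ((a : ℝ) + 1) * ((b : ℝ) + 2) / ((a : ℝ) + b + 2) * dualCoeff (b + 1) (a + b + 2 - k)
  else dualCoeff (a + b + 2 - j) (a + b + 2 - k)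

/-- The gluing of `H₁` with the Dual-OHM matrix with `b` rows, where `n = a + 1 + b`. -/
noncomputable def glueDual {a : ℕ} (H₁ : HMatrix a) (b n : ℕ) : HMatrix n :=
  Matrix.of fun i j => glueEntry H₁ b (i + 1) (j + 1)

theorem glueDual_entry {a b n : ℕ} (H₁ : HMatrix a) {k j : ℕ} (hk : 1 ≤ k) (hk' : k ≤ n)
    (hj : 1 ≤ j) (hj' : j ≤ n) : (glueDual H₁ b n).entry k j = glueEntry H₁ b k j :=
  HMatrix.entry_of _ hk hk' hj hj'

theorem HMatrix.Q_eq_of_right_block {a b n : ℕ} {H₂ : HMatrix b} {H : HMatrix n}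
    (hn : n = a + 1 + b)
    (h : ∀ k ∈ Finset.Icc 1 b, ∀ j ∈ Finset.Icc 1 b,
      H.entry (a + 1 + k) (a + 1 + j) = H₂.entry k j) (m : ℕ) :
    ∀ j, 1 ≤ j → j ≤ b → H.Q (m + 1) (a + 1 + j) = H₂.Q (m + 1) j := by
  subst hn
  induction m with
  | zero =>
    intro j hj hj'
    simp only [HMatrix.Q, sum_Icc_add_eq]
    refine Finset.sum_congr rfl fun i hi => ?_
    rw [Finset.mem_Icc] at hi
    exact h i (Finset.mem_Icc.2 (by omega)) j (Finset.mem_Icc.2 (by omega))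
  | succ m ih =>
    intro j hj hj'
    simp only [HMatrix.Q, sum_Icc_add_eq]
    refine Finset.sum_congr rfl fun i hi => ?_
    rw [Finset.mem_Icc] at hi
    rw [h i (Finset.mem_Icc.2 (by omega)) j (Finset.mem_Icc.2 (by omega)),
      show a + 1 + i + 1 = a + 1 + (i + 1) by ring, sum_Icc_add_eq]
    congr 1
    refine Finset.sum_congr rfl fun j' hj' => ?_
    rw [Finset.mem_Icc] at hj'
    exact ih j' (by omega) hj'.2

/-- If the lower right block is that of Dual-OHM, the numbers `Q(m + 1, a + 1; H)` are binomial
sums over column `a + 1`. -/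
theorem HMatrix.Q_glue_column {a b n : ℕ} {H : HMatrix n} (hn : n = a + 1 + b)
    (h : ∀ k ∈ Finset.Icc 1 b, ∀ j ∈ Finset.Icc 1 b,
      H.entry (a + 1 + k) (a + 1 + j) = (dualOHM b).entry k j) (m : ℕ) :
    H.Q (m + 1) (a + 1) = (∑ t ∈ Finset.range (b + 1),
      H.entry (a + 1 + b - t) (a + 1) * (t.choose m : ℝ)) / (m + 1) := by
  have hsum : ∑ t ∈ Finset.range (b + 1), H.entry (a + 1 + b - t) (a + 1) * (t.choose m : ℝ) =
      ∑ i ∈ Finset.Icc 0 b, H.entry (a + 1 + i) (a + 1) * ((b - i).choose m : ℝ) := by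
    rw [← Nat.sub_zero (b + 1), ← sum_Icc_sub_eq_sum_range _ (by omega)]
    refine Finset.sum_congr rfl fun i hi => ?_
    rw [Finset.mem_Icc] at hi
    rw [show a + 1 + b - (b - i) = a + 1 + i by omega]
  rw [hsum]
  have hQ := fun m => HMatrix.Q_eq_of_right_block (m := m) hn h
  subst hn
  have hIcc := fun f : ℕ → ℝ => sum_Icc_add_eq f (a + 1) 0 b
  rw [add_zero] at hIcc
  rcases m with _ | m
  · simp only [HMatrix.Q, hIcc]
    simp
  · simp only [HMatrix.Q, hIcc]
    rw [Finset.sum_div]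
    refine Finset.sum_congr rfl fun i hi => ?_
    rw [Finset.mem_Icc] at hi
    rw [show a + 1 + i + 1 = a + 1 + (i + 1) by ring, sum_Icc_add_eq, mul_div_assoc,
      ← sum_Icc_choose_sub m hi.2, Finset.sum_div]
    congr 1
    refine Finset.sum_congr rfl fun j hj => ?_
    rw [Finset.mem_Icc] at hj
    rw [hQ m j (by omega) hj.2, dualOHM_Q m j (by omega) hj.2]
    push_cast
    ring_nf

theorem isGluing_glueDual {a b n : ℕ} {H₁ : HMatrix a} (hn : n = a + 1 + b)
    (h₁ : H₁ ∈ OptimalHMatrices.{u} a) (h₂ : dualOHM b ∈ OptimalHMatrices.{u} b) :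
    IsGluing.{u} H₁ (dualOHM b) (glueDual H₁ b n) := by
  have hn' : (n : ℝ) + 1 = a + b + 2 := by subst hn; push_cast; ring
  have hright : ∀ k ∈ Finset.Icc 1 b, ∀ j ∈ Finset.Icc 1 b,
      (glueDual H₁ b n).entry (a + 1 + k) (a + 1 + j) = (dualOHM b).entry k j := by
    intro k hk j hj
    rw [Finset.mem_Icc] at hk hj
    rw [glueDual_entry H₁ (by omega) (by omega) (by omega) (by omega),
      dualOHM_entry hk.1 hk.2 hj.1 hj.2, glueEntry, if_neg (by omega), if_neg (by omega)]
    congr 1 <;> omega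
  refine ⟨h₁, h₂, hn, ?_, ?_, hright, ?_, ?_, ?_, ?_⟩
  · intro i j hij
    rw [Fin.lt_def] at hij
    simp only [glueDual, Matrix.of_apply, glueEntry]
    split_ifs with c1 c2 c3 c4
    · exact HMatrix.entry_eq_zero_of_lt h₁.1 (by omega) (by omega)
    · omega
    · rfl
    · rw [dualCoeff_of_gt (by omega), mul_zero]
    · rw [dualCoeff_of_gt (by omega)]
  · intro k hk j hj
    rw [Finset.mem_Icc] at hk hj
    rw [glueDual_entry H₁ (by omega) (by omega) (by omega) (by omega), glueEntry, if_pos hj.2,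
      if_pos hk.2]
  · intro k hk j hj
    rw [Finset.mem_Icc] at hk hj
    rw [glueDual_entry H₁ (by omega) (by omega) (by omega) (by omega), glueEntry, if_pos hj.2,
      if_neg (by omega), if_neg (by omega)]
  · intro j hj
    rw [Finset.mem_Icc] at hj
    rw [glueDual_entry H₁ (by omega) (by omega) (by omega) (by omega), glueEntry, if_pos hj.2,
      if_neg (by omega), if_pos rfl, hn']
  · rw [glueDual_entry H₁ (by omega) (by omega) (by omega) (by omega), glueEntry,
      if_neg (by omega), if_pos rfl, show a + b + 2 - (a + 1) = b + 1 by omega, dualCoeff_self, hn']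
    push_cast
    field_simp
    ring
  · intro k hk
    rw [Finset.mem_Icc] at hk
    obtain ⟨m, rfl⟩ : ∃ m, k = m + 1 := ⟨k - 1, by omega⟩
    rw [HMatrix.Q_glue_column hn hright]
    have e : ∑ t ∈ Finset.range (b + 1),
        (glueDual H₁ b n).entry (a + 1 + b - t) (a + 1) * (t.choose m : ℝ) =
        ((a : ℝ) + 1) * ((b : ℝ) + 2) / ((a : ℝ) + b + 2) *
          ∑ t ∈ Finset.range (b + 1), dualCoeff (b + 1) (t + 1) * (t.choose m : ℝ) := by
      rw [Finset.mul_sum]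
      refine Finset.sum_congr rfl fun t ht => ?_
      rw [Finset.mem_range] at ht
      rw [glueDual_entry H₁ (by omega) (by omega) (by omega) (by omega), glueEntry,
        if_neg (by omega), if_pos rfl, show a + b + 2 - (a + 1 + b - t) = t + 1 by omega, mul_assoc]
    rw [e, sum_dualCoeff_mul_choose, hn', Nat.add_sub_cancel]
    push_cast
    field_simp
    ring

/-- The conditions on a gluing with Dual-OHM have only one solution. -/
theorem IsGluing.eq_glueDual {a b n : ℕ} {H₁ : HMatrix a} {H : HMatrix n}
    (h : IsGluing.{u} H₁ (dualOHM b) H) : H = glueDual H₁ b n := by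
  have hG := isGluing_glueDual h.size h.optimal_left h.optimal_right
  have hn := h.size
  have hcol : ∀ t ≤ b, H.entry (a + 1 + b - t) (a + 1) =
      (glueDual H₁ b n).entry (a + 1 + b - t) (a + 1) := by
    refine eq_of_sum_mul_choose_eq fun m hm => ?_
    have h1 := h.column (m + 1) (Finset.mem_Icc.2 (by omega))
    rw [← hG.column (m + 1) (Finset.mem_Icc.2 (by omega)), HMatrix.Q_glue_column hn h.right_block,
      HMatrix.Q_glue_column hn hG.right_block] at h1
    have : (m : ℝ) + 1 ≠ 0 := by positivity
    rwa [div_left_inj' this] at h1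
  refine HMatrix.ext_entry fun k j hk hk' hj hj' => ?_
  rcases lt_or_ge k j with hkj | hkj
  · rw [HMatrix.entry_eq_zero_of_lt h.lower hk hkj, HMatrix.entry_eq_zero_of_lt hG.lower hk hkj]
  rcases lt_trichotomy j (a + 1) with hja | rfl | hja
  · have hjm : j ∈ Finset.Icc 1 a := Finset.mem_Icc.2 (by omega)
    rcases lt_trichotomy k (a + 1) with hka | rfl | hka
    · have hkm : k ∈ Finset.Icc 1 a := Finset.mem_Icc.2 (by omega)
      rw [h.left_block k hkm j hjm, hG.left_block k hkm j hjm]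
    · rw [h.row j hjm, hG.row j hjm]
    · obtain ⟨i, rfl⟩ : ∃ i, k = a + 1 + i := ⟨k - (a + 1), by omega⟩
      have him : i ∈ Finset.Icc 1 b := Finset.mem_Icc.2 (by omega)
      rw [h.zero_block i him j hjm, hG.zero_block i him j hjm]
  · have := hcol (a + 1 + b - k) (by omega)
    rwa [show a + 1 + b - (a + 1 + b - k) = k by omega] at this
  · obtain ⟨i, rfl⟩ : ∃ i, k = a + 1 + i := ⟨k - (a + 1), by omega⟩
    obtain ⟨l, rfl⟩ : ∃ l, j = a + 1 + l := ⟨j - (a + 1), by omega⟩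
    have him : i ∈ Finset.Icc 1 b := Finset.mem_Icc.2 (by omega)
    have hlm : l ∈ Finset.Icc 1 b := Finset.mem_Icc.2 (by omega)
    rw [h.right_block i him l hlm, hG.right_block i him l hlm]

theorem glueDual_empty (H₁ : HMatrix 0) (b : ℕ) : glueDual H₁ b (b + 1) = dualOHM (b + 1) := by
  rw [dualOHM_eq_of]
  ext i j
  simp only [glueDual, Matrix.of_apply, glueEntry]
  rw [if_neg (by omega)]
  split_ifs with h
  · have e : ((b : ℝ) + 2) ≠ 0 := by positivity
    rw [h]
    push_cast
    simp only [zero_add, one_mul]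
    rw [div_self e, one_mul]
  · congr 1 <;> omega

/-! ### Convergence across one block -/

section Convergence

variable {X : Type*} [NormedAddCommGroup X] [InnerProductSpace ℝ X]

/-- The `b + 1` updates that lead from `y a` to `y (a + b + 1)`, in the form of the three-case
recurrence with period `b + 1`. -/
structure BlockStep (a b : ℕ) (T : X → X) (y : ℕ → X) : Prop where
  first : y (a + 1) = y a
    - (((b : ℝ) + 1) * (a + 1) / (a + b + 2)) • (y a - T (y a))
    + (((b : ℝ) + 1) / (a + b + 2)) • (y 0 - y a)
  second : 1 ≤ b → y (a + 2) = y (a + 1)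
    + ((b : ℝ) / (b + 1)) • (T (y (a + 1)) - y (a + 1)
      + (((a : ℝ) + 1) / (a + b + 2)) • (y a - T (y a)))
  later : ∀ l : ℕ, 2 ≤ l → l ≤ b → y (a + l + 1) = y (a + l)
    + (((b : ℝ) + 1 - l) / ((b : ℝ) + 2 - l)) • (T (y (a + l)) - T (y (a + l - 1)))

/-- The inequality `n / 2 * ‖g‖ ^ 2 + ⟪g, y n - y 0⟫ ≤ 0` for the residual `g = y n - T (y n)`: it is
trivial for `n = 0`, passes from the start of a block to its end, and with nonexpansiveness at a
fixed point gives the rate of convergence. -/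
def AnchorInequality (T : X → X) (y : ℕ → X) (n : ℕ) : Prop :=
  (n : ℝ) / 2 * ‖y n - T (y n)‖ ^ 2 + inner ℝ (y n - T (y n)) (y n - y 0) ≤ 0

theorem anchorInequality_zero (T : X → X) (y : ℕ → X) : AnchorInequality T y 0 := by
  simp [AnchorInequality]

theorem Nonexpansive.half_sq_le_inner {T : X → X} (hT : Nonexpansive T) (x z : X) :
    ‖(x - T x) - (z - T z)‖ ^ 2 / 2 ≤ inner ℝ ((x - T x) - (z - T z)) (x - z) := by
  have h1 : ‖T x - T z‖ ^ 2 ≤ ‖x - z‖ ^ 2 := by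
    have := hT x z
    gcongr
  have h2 : T x - T z = (x - z) - ((x - T x) - (z - T z)) := by abel
  rw [h2, norm_sub_sq_real, real_inner_comm] at h1
  linarith

theorem AnchorInequality.norm_sq_le {T : X → X} (hT : Nonexpansive T) {y : ℕ → X} {ystar : X}
    (hs : T ystar = ystar) {n : ℕ} (h : AnchorInequality T y n) :
    ‖y n - T (y n)‖ ^ 2 ≤ 4 * ‖y 0 - ystar‖ ^ 2 / ((n : ℝ) + 1) ^ 2 := by
  have h1 := hT.half_sq_le_inner (y n) ystar
  rw [hs, sub_self, sub_zero] at h1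
  unfold AnchorInequality at h
  set g := y n - T (y n) with hg
  have h2 : inner ℝ g (y n - ystar) = inner ℝ g (y n - y 0) + inner ℝ g (y 0 - ystar) := by
    rw [← inner_add_right]; congr 1; abel
  have h3 := real_inner_le_norm g (y 0 - ystar)
  have h4 : ((n : ℝ) + 1) * ‖g‖ ^ 2 ≤ 2 * (‖g‖ * ‖y 0 - ystar‖) := by linarith
  have h5 : ((n : ℝ) + 1) * ‖g‖ ≤ 2 * ‖y 0 - ystar‖ := by
    rcases (norm_nonneg g).eq_or_lt with h0 | h0
    · rw [← h0]; simp
    · nlinarith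
  rw [le_div_iff₀ (by positivity)]
  have h6 : (((n : ℝ) + 1) * ‖g‖) ^ 2 ≤ (2 * ‖y 0 - ystar‖) ^ 2 := by gcongr
  linarith

/-- One step of the telescoping inside a block. At an iterate from which `q` updates lead to the end
of the block, `h` is its residual minus the final one, `D` the final iterate minus this one, `D'`
the final iterate minus the next one; `s` and `s'` are the scaled increments before and after. The
left side is nonpositive when `T` is nonexpansive. -/
theorem telescope_identity {s s' h D D' : X} {q : ℝ}
    (hs : h = (q * (q + 1)) • (s' - s)) (hD : D = D' + q • s' - h) :
    (‖h‖ ^ 2 / 2 + inner ℝ h D) =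
      q * (q + 1) * ((inner ℝ s' D' - q * (q - 1) / 2 * ‖s'‖ ^ 2) -
        (inner ℝ s D - q * (q + 1) / 2 * ‖s‖ ^ 2)) := by
  subst hD
  subst hs
  simp only [← real_inner_self_eq_norm_sq, inner_add_right, inner_sub_left,
    inner_sub_right, inner_smul_left, inner_smul_right, RCLike.conj_to_real,
    real_inner_comm s s']
  ring

/-- The potential at the second iterate of a block is nonnegative: it decreases along the block, by
nonexpansiveness between each iterate and the final one, and vanishes at the end. -/
theorem BlockStep.potential_nonneg {T : X → X} (hT : Nonexpansive T) {y : ℕ → X} {a b : ℕ}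
    (h : BlockStep a b T y) :
    0 ≤ inner ℝ ((1 / ((b : ℝ) + 1)) • ((((a : ℝ) + 1) / (a + b + 2)) • (y a - T (y a))
        - (y (a + b + 1) - T (y (a + b + 1))))) (y (a + b + 1) - y (a + 1))
      - ((b : ℝ) + 1) * b / 2 *
        ‖(1 / ((b : ℝ) + 1)) • ((((a : ℝ) + 1) / (a + b + 2)) • (y a - T (y a))
        - (y (a + b + 1) - T (y (a + b + 1))))‖ ^ 2 := by
  set G := y (a + b + 1) - T (y (a + b + 1)) with hG
  -- `s l` is the increment `y (a + l + 1) - y (a + l)` plus the residual difference, divided by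
  -- the number `b + 1 - l` of updates left; `s 0` is chosen to fit the second update.
  let s : ℕ → X := fun l => if l = 0 then
      (1 / ((b : ℝ) + 1)) • ((((a : ℝ) + 1) / (a + b + 2)) • (y a - T (y a)) - G)
    else (1 / ((b : ℝ) + 1 - l)) • (y (a + l + 1) - T (y (a + l)) - G)
  let P : ℕ → ℝ := fun l => inner ℝ (s l) (y (a + b + 1) - y (a + l + 1))
    - ((b : ℝ) - l + 1) * (b - l) / 2 * ‖s l‖ ^ 2
  have hstep : ∀ l < b, P (l + 1) ≤ P l := by
    intro l hl
    have hl' : (l : ℝ) + 1 ≤ b := by exact_mod_cast hl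
    have hq : 0 < (b : ℝ) - l := by linarith
    have hs1 : s (l + 1) = (1 / ((b : ℝ) - l)) • (y (a + l + 2) - T (y (a + l + 1)) - G) := by
      simp only [s, Nat.succ_ne_zero, if_false]
      push_cast
      rw [show (b : ℝ) + 1 - (l + 1) = b - l by ring]
      rfl
    have hrec : y (a + l + 2) - y (a + l + 1) = ((b : ℝ) - l) • s l
        - (((b : ℝ) - l) / (b - l + 1)) • ((y (a + l + 1) - T (y (a + l + 1))) - G) := by
      rcases Nat.eq_zero_or_pos l with rfl | hpos
      · have := h.second (by omega)
        simp only [s, if_true, add_zero, Nat.cast_zero, sub_zero]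
        rw [this]
        module
      · have := h.later (l + 1) (by omega) (by omega)
        simp only [s, hpos.ne', if_false]
        have e : a + (l + 1) + 1 = a + l + 2 := by ring
        have e2 : a + (l + 1) = a + l + 1 := by ring
        have e3 : a + l + 1 - 1 = a + l := by omega
        rw [e, e2, e3] at this
        push_cast at this
        rw [show (b : ℝ) + 1 - (l + 1) = b - l by ring,
          show (b : ℝ) + 2 - (l + 1) = b - l + 1 by ring] at this
        rw [this, show (b : ℝ) + 1 - l = b - l + 1 by ring]
        module
    have hid := telescope_identity (s := s l) (s' := s (l + 1))
      (h := (y (a + l + 1) - T (y (a + l + 1))) - G) (D := y (a + b + 1) - y (a + l + 1))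
      (D' := y (a + b + 1) - y (a + l + 2)) (q := (b : ℝ) - l)
      (by
        have e : y (a + l + 2) = y (a + l + 1) + (((b : ℝ) - l) • s l
          - (((b : ℝ) - l) / (b - l + 1)) • ((y (a + l + 1) - T (y (a + l + 1))) - G)) := by
          rw [← hrec]; abel
        rw [hs1, e]
        have : (b : ℝ) - l + 1 ≠ 0 := by positivity
        match_scalars <;> field_simp <;> ring)
      (by
        rw [hs1, smul_smul, mul_one_div_cancel hq.ne', one_smul]
        abel)
    have hT' := hT.half_sq_le_inner (y (a + l + 1)) (y (a + b + 1))
    rw [← hG] at hT'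
    rw [← neg_sub (y (a + b + 1)) (y (a + l + 1)), inner_neg_right] at hT'
    have hle : P (l + 1) - P l ≤ 0 := by
      have e : P (l + 1) - P l = (inner ℝ (s (l + 1)) (y (a + b + 1) - y (a + l + 2))
          - ((b : ℝ) - l) * ((b : ℝ) - l - 1) / 2 * ‖s (l + 1)‖ ^ 2) -
        (inner ℝ (s l) (y (a + b + 1) - y (a + l + 1))
          - ((b : ℝ) - l) * ((b : ℝ) - l + 1) / 2 * ‖s l‖ ^ 2) := by
        simp only [P]
        push_cast
        rw [show a + (l + 1) + 1 = a + l + 2 by ring]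
        ring
      rw [e]
      by_contra hc
      rw [not_le] at hc
      have : 0 < ((b : ℝ) - l) * ((b : ℝ) - l + 1) := by positivity
      have := mul_pos this hc
      linarith
    linarith
  have hmono : ∀ l ≤ b, P l ≤ P 0 := by
    intro l
    induction l with
    | zero => intro _; exact le_rfl
    | succ l ih => intro hl; exact (hstep l hl).trans (ih (by omega))
  have h0 := hmono b le_rfl
  have hb : P b = 0 := by simp [P]
  rw [hb] at h0
  simpa [P, s] using h0

theorem BlockStep.anchorInequality {T : X → X} (hT : Nonexpansive T) {y : ℕ → X} {a b : ℕ}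
    (h : BlockStep a b T y) (ha : AnchorInequality T y a) :
    AnchorInequality T y (a + b + 1) := by
  have hP := h.potential_nonneg hT
  have hI := hT.half_sq_le_inner (y a) (y (a + b + 1))
  unfold AnchorInequality at ha ⊢
  have hM : (0 : ℝ) < a + b + 2 := by positivity
  have hd : y 0 = y a + ((a : ℝ) + 1) • (y a - T (y a))
      + (((a : ℝ) + b + 2) / (b + 1)) • (y (a + 1) - y a) := by
    rw [h.first]
    match_scalars <;> field_simp <;> ring
  generalize y (a + b + 1) - T (y (a + b + 1)) = G at *
  generalize y a - T (y a) = g at *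
  have e1 : y a - y 0 = -(((a : ℝ) + 1) • g
      + (((a : ℝ) + b + 2) / (b + 1)) • (y (a + 1) - y a)) := by rw [hd]; abel
  have e2 : y (a + b + 1) - y 0 = (y (a + b + 1) - y (a + 1)) + (y (a + 1) - y a)
    -(((a : ℝ) + 1) • g + (((a : ℝ) + b + 2) / (b + 1)) • (y (a + 1) - y a)) := by rw [hd]; abel
  have e3 : y a - y (a + b + 1) = -((y (a + b + 1) - y (a + 1)) + (y (a + 1) - y a)) := by abel
  rw [e1] at ha
  rw [e2]
  rw [e3] at hI
  generalize y (a + b + 1) - y (a + 1) = D at *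
  generalize y (a + 1) - y a = d at *
  -- the certificate: `(a+1)/(a+b+2)` times the inequality at `a`, `(a+1)/(b+1)` times
  -- nonexpansiveness between the ends of the block, and `a+b+2` times the potential
  have c1 : (0 : ℝ) ≤ (a + 1) / (a + b + 2) := by positivity
  have c2 : (0 : ℝ) ≤ (a + 1) / (b + 1) := by positivity
  have f1 := mul_nonneg hM.le hP
  have f2 := mul_nonneg c2 (sub_nonneg.2 hI)
  have f3 := mul_nonneg c1 (neg_nonneg.2 ha)
  have f := add_nonneg (add_nonneg f1 f2) f3
  rw [← neg_nonneg]
  refine f.trans_eq ?_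
  simp only [← real_inner_self_eq_norm_sq, inner_add_right, inner_sub_left,
    inner_sub_right, inner_smul_left, inner_smul_right, inner_neg_right,
    RCLike.conj_to_real, real_inner_comm g G]
  push_cast
  field_simp
  ring

end Convergence

/-! ### Runs of glued matrices -/

section Runs

variable {X : Type*} [NormedAddCommGroup X] [InnerProductSpace ℝ X]

theorem RunsHMatrix.congr_entry {a n : ℕ} {H₁ : HMatrix a} {H : HMatrix n} {T : X → X} {y : ℕ → X}
    (han : a ≤ n) (he : ∀ k ∈ Finset.Icc 1 a, ∀ j ∈ Finset.Icc 1 a, H.entry k j = H₁.entry k j)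
    (h : RunsHMatrix H T y) : RunsHMatrix H₁ T y := by
  intro k hk
  rw [h k (by omega)]
  congr 1
  refine Finset.sum_congr rfl fun j hj => ?_
  rw [Finset.mem_range] at hj
  rw [he _ (Finset.mem_Icc.2 (by omega)) _ (Finset.mem_Icc.2 (by omega))]

/-- The column sums of an H-matrix recover the total displacement of a run. -/
theorem RunsHMatrix.sum_column_smul {a : ℕ} {H₁ : HMatrix a} {T : X → X} {y : ℕ → X}
    (h : RunsHMatrix H₁ T y) :
    ∑ j ∈ Finset.range a, (∑ i ∈ Finset.Icc (j + 1) a, H₁.entry i (j + 1)) • (y j - T (y j)) =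
      y 0 - y a := by
  rw [← Finset.sum_range_sub']
  have h1 : ∀ k ∈ Finset.range a, y k - y (k + 1) =
      ∑ j ∈ Finset.range (k + 1), H₁.entry (k + 1) (j + 1) • (y j - T (y j)) := by
    intro k hk
    rw [h k (Finset.mem_range.1 hk)]
    abel
  rw [Finset.sum_congr rfl h1]
  simp only [Finset.sum_smul]
  rw [Finset.sum_sigma', Finset.sum_sigma']
  refine Finset.sum_nbij' (fun x => ⟨x.2 - 1, x.1⟩) (fun x => ⟨x.2, x.1 + 1⟩) ?_ ?_ ?_ ?_ ?_
  · rintro ⟨j, i⟩ hx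
    simp only [Finset.mem_sigma, Finset.mem_range, Finset.mem_Icc] at hx ⊢
    omega
  · rintro ⟨k, j⟩ hx
    simp only [Finset.mem_sigma, Finset.mem_range, Finset.mem_Icc] at hx ⊢
    omega
  · rintro ⟨j, i⟩ hx
    simp only [Finset.mem_sigma, Finset.mem_range, Finset.mem_Icc] at hx
    simp only [Nat.sub_add_cancel (show 1 ≤ i by omega)]
  · rintro ⟨k, j⟩ _
    simp
  · rintro ⟨j, i⟩ hx
    simp only [Finset.mem_sigma, Finset.mem_range, Finset.mem_Icc] at hx
    simp only [Nat.sub_add_cancel (show 1 ≤ i by omega)]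

/-- Consecutive entries below the diagonal of a column of Dual-OHM have a ratio that does not
depend on the column; hence each update is a multiple of the previous one up to two new terms. -/
theorem dualCoeff_eq_ratio_mul {r t : ℕ} (h : t + 1 < r) :
    dualCoeff r t = (t : ℝ) / (t + 1) * dualCoeff r (t + 1) := by
  rw [dualCoeff_of_lt h, dualCoeff_of_lt (by omega)]
  have : (r : ℝ) ≠ 0 := by
    have : r ≠ 0 := by omega
    exact_mod_cast this
  push_cast
  field_simp

theorem glueEntry_eq_ratio_mul {a : ℕ} (H₁ : HMatrix a) {m c j : ℕ} (hj : j ≤ a + m + 1) :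
    glueEntry H₁ (m + 2 + c) (a + m + 3) j =
      ((c : ℝ) + 1) / (c + 2) * glueEntry H₁ (m + 2 + c) (a + m + 2) j := by
  have e1 : a + (m + 2 + c) + 2 - (a + m + 3) = c + 1 := by omega
  have e2 : a + (m + 2 + c) + 2 - (a + m + 2) = c + 1 + 1 := by omega
  have e3 : (((c + 1 : ℕ) : ℝ)) / (((c + 1 : ℕ) : ℝ) + 1) = ((c : ℝ) + 1) / (c + 2) := by
    push_cast; ring_nf
  unfold glueEntry
  rw [e1, e2]
  split_ifs
  all_goals first
    | omega
    | rw [mul_zero]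
    | (rw [dualCoeff_eq_ratio_mul (by omega), e3]; ring)
    | rw [dualCoeff_eq_ratio_mul (by omega), e3]

theorem RunsHMatrix.left_of_glueDual {a b n : ℕ} {H₁ : HMatrix a} (hn : n = a + 1 + b)
    {T : X → X} {y : ℕ → X} (h : RunsHMatrix (glueDual H₁ b n) T y) : RunsHMatrix H₁ T y := by
  refine h.congr_entry (by omega) fun k hk j hj => ?_
  rw [Finset.mem_Icc] at hk hj
  rw [glueDual_entry H₁ (by omega) (by omega) (by omega) (by omega), glueEntry, if_pos hj.2,
    if_pos hk.2]

theorem RunsHMatrix.blockStep {a b n : ℕ} {H₁ : HMatrix a} (hn : n = a + 1 + b)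
    {T : X → X} {y : ℕ → X} (h : RunsHMatrix (glueDual H₁ b n) T y) : BlockStep a b T y := by
  have hrow : ∀ l ≤ b, y (a + l + 1) = y (a + l) -
      ∑ j ∈ Finset.range (a + l + 1), glueEntry H₁ b (a + l + 1) (j + 1) • (y j - T (y j)) := by
    intro l hl
    rw [h (a + l) (by omega)]
    congr 1
    refine Finset.sum_congr rfl fun j hj => ?_
    rw [Finset.mem_range] at hj
    rw [glueDual_entry H₁ (by omega) (by omega) (by omega) (by omega)]
  refine ⟨?_, ?_, ?_⟩
  · have h0 := hrow 0 (by omega)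
    rw [add_zero, Finset.sum_range_succ] at h0
    have hs : ∑ j ∈ Finset.range a, glueEntry H₁ b (a + 1) (j + 1) • (y j - T (y j)) =
        (-(((b : ℝ) + 1) / ((a : ℝ) + b + 2))) • (y 0 - y a) := by
      rw [← (h.left_of_glueDual hn).sum_column_smul, Finset.smul_sum]
      refine Finset.sum_congr rfl fun j hj => ?_
      rw [Finset.mem_range] at hj
      rw [glueEntry, if_pos (by omega), if_neg (by omega), if_pos rfl, mul_smul]
    have hc : glueEntry H₁ b (a + 1) (a + 1) = ((b : ℝ) + 1) * (a + 1) / (a + b + 2) := by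
      rw [glueEntry, if_neg (by omega), if_pos rfl, show a + b + 2 - (a + 1) = b + 1 by omega,
        dualCoeff_self]
      push_cast
      field_simp
      ring
    rw [h0, hs, hc]
    module
  · intro hb
    obtain ⟨c, rfl⟩ : ∃ c, b = c + 1 := ⟨b - 1, by omega⟩
    have h1 := hrow 1 hb
    have hs : ∑ j ∈ Finset.range a, glueEntry H₁ (c + 1) (a + 1 + 1) (j + 1) • (y j - T (y j)) =
        0 := by
      refine Finset.sum_eq_zero fun j hj => ?_
      rw [Finset.mem_range] at hj
      rw [glueEntry, if_pos (by omega), if_neg (by omega), if_neg (by omega), zero_smul]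
    have hc : glueEntry H₁ (c + 1) (a + 1 + 1) (a + 1) =
        -(((c : ℝ) + 1) / (c + 2) * ((a + 1) / (a + c + 3))) := by
      rw [glueEntry, if_neg (by omega), if_pos rfl,
        show a + (c + 1) + 2 - (a + 1 + 1) = c + 1 by omega, dualCoeff_of_lt (by omega)]
      push_cast
      have e1 : (a : ℝ) + (c + 1) + 2 ≠ 0 := by positivity
      have e2 : (a : ℝ) + c + 3 ≠ 0 := by positivity
      field_simp
      ring
    have hd : glueEntry H₁ (c + 1) (a + 1 + 1) (a + 1 + 1) = ((c : ℝ) + 1) / (c + 2) := by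
      rw [glueEntry, if_neg (by omega), if_neg (by omega),
        show a + (c + 1) + 2 - (a + 1 + 1) = c + 1 by omega, dualCoeff_self]
      push_cast
      ring
    rw [Finset.sum_range_succ, Finset.sum_range_succ, hs, hc, hd] at h1
    rw [show a + 2 = a + 1 + 1 by ring, h1]
    push_cast
    rw [show (a : ℝ) + (c + 1) + 2 = a + c + 3 by ring, show (c : ℝ) + 1 + 1 = c + 2 by ring]
    module
  · intro l hl hlb
    obtain ⟨m, rfl⟩ : ∃ m, l = m + 2 := ⟨l - 2, by omega⟩
    obtain ⟨c, rfl⟩ : ∃ c, b = m + 2 + c := ⟨b - (m + 2), by omega⟩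
    have h1 := hrow (m + 1) (by omega)
    have h2 := hrow (m + 2) (by omega)
    simp only [← add_assoc] at h1 h2 ⊢
    rw [show a + m + 2 - 1 = a + m + 1 by omega]
    rw [show a + m + 1 + 1 = a + m + 2 by ring, Finset.sum_range_succ] at h1
    rw [show a + m + 2 + 1 = a + m + 3 by ring, Finset.sum_range_succ, Finset.sum_range_succ] at h2
    rw [show a + m + 2 + 1 = a + m + 3 by ring]
    have hs : ∑ j ∈ Finset.range (a + m + 1),
          glueEntry H₁ (m + 2 + c) (a + m + 3) (j + 1) • (y j - T (y j)) =
        (((c : ℝ) + 1) / (c + 2)) • ∑ j ∈ Finset.range (a + m + 1),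
          glueEntry H₁ (m + 2 + c) (a + m + 2) (j + 1) • (y j - T (y j)) := by
      rw [Finset.smul_sum]
      refine Finset.sum_congr rfl fun j hj => ?_
      rw [Finset.mem_range] at hj
      rw [glueEntry_eq_ratio_mul H₁ (by omega), mul_smul]
    have d1 : glueEntry H₁ (m + 2 + c) (a + m + 2) (a + m + 1 + 1) = ((c : ℝ) + 2) / (c + 3) := by
      rw [glueEntry, if_neg (by omega), if_neg (by omega),
        show a + (m + 2 + c) + 2 - (a + m + 2) = c + 2 by omega, dualCoeff_self]
      push_cast
      ring
    have d2 : glueEntry H₁ (m + 2 + c) (a + m + 3) (a + m + 1 + 1) =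
        -(((c : ℝ) + 1) / ((c + 2) * (c + 3))) := by
      rw [glueEntry, if_neg (by omega), if_neg (by omega),
        show a + (m + 2 + c) + 2 - (a + m + 1 + 1) = c + 2 by omega,
        show a + (m + 2 + c) + 2 - (a + m + 3) = c + 1 by omega, dualCoeff_of_lt (by omega)]
      push_cast
      ring
    have d3 : glueEntry H₁ (m + 2 + c) (a + m + 3) (a + m + 2 + 1) = ((c : ℝ) + 1) / (c + 2) := by
      rw [glueEntry, if_neg (by omega), if_neg (by omega),
        show a + (m + 2 + c) + 2 - (a + m + 2 + 1) = c + 1 by omega, dualCoeff_self]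
      push_cast
      ring
    rw [hs, d2, d3] at h2
    rw [d1] at h1
    generalize ∑ j ∈ Finset.range (a + m + 1),
          glueEntry H₁ (m + 2 + c) (a + m + 2) (j + 1) • (y j - T (y j)) = S at h1 h2
    have hS : S = y (a + m + 1) - y (a + m + 2)
        - (((c : ℝ) + 2) / (c + 3)) • (y (a + m + 1) - T (y (a + m + 1))) := by
      rw [h1]
      abel
    rw [hS] at h2
    rw [h2]
    push_cast
    rw [show (m : ℝ) + 2 + c + 1 - (m + 2) = c + 1 by ring,
      show (m : ℝ) + 2 + c + 2 - (m + 2) = c + 2 by ring]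
    match_scalars <;> field_simp <;> ring

/-- A sequence generated by step sizes `h k j` (0-indexed) from the starting point `y0`. -/
noncomputable def stepSequence (h : ℕ → ℕ → ℝ) (T : X → X) (y0 : X) : ℕ → X
  | 0 => y0
  | k + 1 => stepSequence h T y0 k -
      ∑ j : Fin (k + 1), h k j • (stepSequence h T y0 j - T (stepSequence h T y0 j))

theorem stepSequence_succ (h : ℕ → ℕ → ℝ) (T : X → X) (y0 : X) (k : ℕ) :
    stepSequence h T y0 (k + 1) = stepSequence h T y0 k - ∑ j ∈ Finset.range (k + 1),
      h k j • (stepSequence h T y0 j - T (stepSequence h T y0 j)) := by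
  rw [stepSequence, Finset.sum_range]

/-! ### The three-case recurrence -/

theorem rdoRecurrence_iff (b : ℕ) (T : X → X) (y : ℕ → X) :
    RDORecurrence (b + 1) T y ↔ ∀ k, BlockStep (k * (b + 1)) b T y := by
  have e1 : ∀ k : ℕ, ((k : ℝ) + 1) * ((b + 1 : ℕ) : ℝ) + 1 = ((k * (b + 1) : ℕ) : ℝ) + b + 2 := by
    intro k; push_cast; ring
  have e2 : ∀ k : ℕ, (k : ℝ) * ((b + 1 : ℕ) : ℝ) = ((k * (b + 1) : ℕ) : ℝ) := by
    intro k; push_cast; ring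
  have e3 : ((b + 1 : ℕ) : ℝ) - 1 = b := by push_cast; ring
  have e4 : ∀ l : ℕ, (b : ℝ) + 1 - (l : ℝ) + 1 = b + 2 - l := by
    intro l; ring
  refine forall_congr' fun k => ?_
  rw [e1, e2, e3]
  simp only [Nat.add_sub_cancel, Nat.cast_add_one b, e4]
  constructor
  · rintro ⟨h1, h2, h3⟩
    exact ⟨h1, fun hb => h2 (by omega), h3⟩
  · rintro ⟨h1, h2, h3⟩
    exact ⟨h1, fun hb => h2 (by omega), h3⟩

/-- The state of the low-memory scheme after `k * p + l` updates: the current iterate and the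
vector stored by the last update. -/
theorem RDORecurrence.eq_rdoLowMemory {p : ℕ} (hp : 1 ≤ p) {T : X → X} {y : ℕ → X}
    (h : RDORecurrence p T y) (n : ℕ) :
    (rdoLowMemory p T (y 0) n).1 = y n ∧
      (n % p = 1 → (rdoLowMemory p T (y 0) n).2 = y (n - 1) - T (y (n - 1))) ∧
      (2 ≤ n % p → (rdoLowMemory p T (y 0) n).2 = T (y (n - 1))) := by
  induction n with
  | zero => simp [rdoLowMemory]
  | succ n ih =>
    obtain ⟨ih1, ih2, ih3⟩ := ih
    obtain ⟨h1, h2, h3⟩ := h (n / p)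
    have hn : n / p * p + n % p = n := Nat.div_add_mod' n p
    have hlt : n % p < p := Nat.mod_lt _ hp
    have hmod : (n + 1) % p = n % p + 1 ∨ (n + 1) % p = 0 := by
      rw [← Nat.mod_add_mod n p 1]
      rcases Nat.lt_or_ge (n % p + 1) p with hl | hl
      · exact Or.inl (Nat.mod_eq_of_lt hl)
      · rw [show n % p + 1 = p by omega]
        exact Or.inr (Nat.mod_self p)
    simp only [rdoLowMemory, ih1, Nat.add_sub_cancel]
    rcases Nat.lt_trichotomy (n % p) 1 with hl | hl | hl
    · have hl0 : n % p = 0 := by omega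
      rw [hl0, add_zero] at hn
      rw [hn] at h1
      simp only [hl0, if_true]
      exact ⟨h1.symm, fun _ => trivial, fun _ => by omega⟩
    · rw [hl] at hn
      rw [show n / p * p + 2 = n + 1 by omega, hn, show n / p * p = n - 1 by omega] at h2
      rw [ih2 hl]
      simp only [hl, one_ne_zero, if_false, if_true]
      exact ⟨(h2 (by omega)).symm, fun _ => by omega, fun _ => trivial⟩
    · have h3' := h3 (n % p) (by omega) (by omega)
      rw [hn] at h3'
      rw [ih3 hl]
      simp only [show ¬ n % p = 0 by omega, show ¬ n % p = 1 by omega, if_false]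
      exact ⟨h3'.symm, fun _ => by omega, fun _ => trivial⟩

end Runs

/-! ### The H-matrices of Repeated Dual-OHM -/

theorem mem_optimalHMatrices_of_anchorInequality {n : ℕ} {H : HMatrix n}
    (hlow : ∀ i j : Fin n, i < j → H i j = 0)
    (h : ∀ (X : Type u) [NormedAddCommGroup X] [InnerProductSpace ℝ X] (T : X → X) (y : ℕ → X),
      Nonexpansive T → RunsHMatrix H T y → AnchorInequality T y n) :
    H ∈ OptimalHMatrices.{u} n :=
  ⟨hlow, fun X _ _ _ T y _ hT hs hy => (h X T y hT hy).norm_sq_le hT hs⟩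

theorem mem_optimalHMatrices_of_eq_zero {n : ℕ} (hn : n = 0) (H : HMatrix n) :
    H ∈ OptimalHMatrices.{u} n := by
  subst hn
  exact mem_optimalHMatrices_of_anchorInequality (fun i => i.elim0)
    fun X _ _ T y _ _ => anchorInequality_zero T y

/-- Dual-OHM is a single block that starts from the empty matrix. -/
theorem dualOHM_mem_optimalHMatrices (b : ℕ) : dualOHM b ∈ OptimalHMatrices.{u} b := by
  rcases b with _ | b
  · exact mem_optimalHMatrices_of_eq_zero rfl _
  · refine mem_optimalHMatrices_of_anchorInequality ?_ fun X _ _ T y hT hy => ?_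
    · intro i j hij
      rw [Fin.lt_def] at hij
      rw [dualOHM_eq_of, Matrix.of_apply, dualCoeff_of_gt (by omega)]
    · rw [← glueDual_empty 0] at hy
      have := (hy.blockStep (by omega)).anchorInequality hT (anchorInequality_zero T y)
      rwa [Nat.zero_add] at this

/-- The H-matrices of Repeated Dual-OHM with period `b + 1`. -/
noncomputable def rdoMatrix (b : ℕ) : (n : ℕ) → HMatrix (n * (b + 1))
  | 0 => 0
  | n + 1 => glueDual (rdoMatrix b n) b ((n + 1) * (b + 1))

theorem succ_mul_succ_eq (b n : ℕ) : (n + 1) * (b + 1) = n * (b + 1) + 1 + b := by ring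

section Runs

variable {X : Type*} [NormedAddCommGroup X] [InnerProductSpace ℝ X]

theorem RunsHMatrix.blockStep_of_rdoMatrix {b : ℕ} {T : X → X} {y : ℕ → X} {n : ℕ}
    (h : RunsHMatrix (rdoMatrix b n) T y) : ∀ k < n, BlockStep (k * (b + 1)) b T y := by
  induction n with
  | zero => intro k hk; omega
  | succ n ih =>
    intro k hk
    rw [rdoMatrix] at h
    rcases Nat.lt_succ_iff_lt_or_eq.1 hk with hk | rfl
    · exact ih (h.left_of_glueDual (succ_mul_succ_eq b n)) k hk
    · exact h.blockStep (succ_mul_succ_eq b k)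

theorem anchorInequality_of_blockStep {b : ℕ} {T : X → X} (hT : Nonexpansive T) {y : ℕ → X}
    {n : ℕ} (h : ∀ k < n, BlockStep (k * (b + 1)) b T y) :
    AnchorInequality T y (n * (b + 1)) := by
  induction n with
  | zero => rw [Nat.zero_mul]; exact anchorInequality_zero T y
  | succ n ih =>
    have := (h n (Nat.lt_succ_self n)).anchorInequality hT (ih fun k hk => h k (by omega))
    rwa [show n * (b + 1) + b + 1 = (n + 1) * (b + 1) by ring] at this

end Runs

theorem rdoMatrix_mem_optimalHMatrices (b n : ℕ) :
    rdoMatrix b n ∈ OptimalHMatrices.{u} (n * (b + 1)) := by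
  induction n with
  | zero => exact mem_optimalHMatrices_of_eq_zero (Nat.zero_mul _) _
  | succ n ih =>
    refine mem_optimalHMatrices_of_anchorInequality ?_ fun X _ _ T y hT hy =>
      anchorInequality_of_blockStep hT hy.blockStep_of_rdoMatrix
    exact (isGluing_glueDual (succ_mul_succ_eq b n) ih (dualOHM_mem_optimalHMatrices b)).lower

theorem isRDOFamily_rdoMatrix (b : ℕ) : IsRDOFamily.{u} (b + 1) (rdoMatrix b) := fun n =>
  isGluing_glueDual (succ_mul_succ_eq b n) (rdoMatrix_mem_optimalHMatrices b n)
    (dualOHM_mem_optimalHMatrices b)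

theorem IsRDOFamily.eq_rdoMatrix {b : ℕ} {H : (n : ℕ) → HMatrix (n * (b + 1))}
    (h : IsRDOFamily.{u} (b + 1) H) : H = rdoMatrix b := by
  funext n
  induction n with
  | zero =>
    ext i
    exact absurd i.isLt (by simp)
  | succ n ih =>
    have := (h n).eq_glueDual
    rw [ih] at this
    exact this

theorem rdoMatrix_entry_of_lt (b : ℕ) {m n : ℕ} (hmn : m < n) :
    ∀ k ∈ Finset.Icc 1 (m * (b + 1)), ∀ j ∈ Finset.Icc 1 (m * (b + 1)),
      (rdoMatrix b n).entry k j = (rdoMatrix b m).entry k j := by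
  induction n with
  | zero => omega
  | succ n ih =>
    intro k hk j hj
    have hle : m * (b + 1) ≤ n * (b + 1) := Nat.mul_le_mul_right _ (by omega)
    have h := (isRDOFamily_rdoMatrix.{0} b n).left_block k
      (Finset.Icc_subset_Icc_right hle hk) j (Finset.Icc_subset_Icc_right hle hj)
    rw [h]
    rcases Nat.lt_succ_iff_lt_or_eq.1 hmn with hlt | rfl
    · exact ih hlt k hk j hj
    · rfl

theorem exists_runs_rdoMatrix {X : Type*} [NormedAddCommGroup X] [InnerProductSpace ℝ X] (b : ℕ)
    (T : X → X) (y0 : X) : ∃ y : ℕ → X, y 0 = y0 ∧ ∀ n, RunsHMatrix (rdoMatrix b n) T y := by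
  -- row `k + 1` is read off from the matrix with `(k + 1) * (b + 1)` rows, which contains it
  refine ⟨stepSequence (fun k j => (rdoMatrix b (k + 1)).entry (k + 1) (j + 1)) T y0,
    by rw [stepSequence], fun n k hk => ?_⟩
  rw [stepSequence_succ]
  congr 1
  refine Finset.sum_congr rfl fun j hj => ?_
  rw [Finset.mem_range] at hj
  congr 1
  have hk' : k + 1 ≤ (k + 1) * (b + 1) := Nat.le_mul_of_pos_right _ (Nat.succ_pos b)
  rcases lt_trichotomy (k + 1) n with h | h | h
  · exact (rdoMatrix_entry_of_lt b h _ (Finset.mem_Icc.2 (by omega)) _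
      (Finset.mem_Icc.2 (by omega))).symm
  · rw [h]
  · exact rdoMatrix_entry_of_lt b h _ (Finset.mem_Icc.2 (by omega)) _
      (Finset.mem_Icc.2 (by omega))

theorem mainTheorem12 (p : ℕ) (hp : 1 ≤ p) :
    -- the H-matrices of Repeated Dual-OHM are well defined
    (∃! H : (n : ℕ) → HMatrix (n * p), IsRDOFamily.{u} p H) ∧
    ∀ H : (n : ℕ) → HMatrix (n * p), IsRDOFamily.{u} p H →
      -- they are optimal, and each is the upper left submatrix of all later ones
      (∀ n, H n ∈ OptimalHMatrices.{u} (n * p)) ∧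
      (∀ m n, m < n → ∀ k ∈ Finset.Icc 1 (m * p), ∀ j ∈ Finset.Icc 1 (m * p),
        (H n).entry k j = (H m).entry k j) ∧
      ∀ (X : Type u) [NormedAddCommGroup X] [InnerProductSpace ℝ X] [CompleteSpace X]
        (T : X → X),
        -- the three-case recurrence defines the algorithm
        (∀ y : ℕ → X, (∀ n, RunsHMatrix (H n) T y) ↔ RDORecurrence p T y) ∧
        -- from each starting point the algorithm produces exactly one sequence, and that sequence
        -- is computed by storing only `y 0` and one past vector besides the current iterate
        (∀ y0 : X, ∃! y : ℕ → X, y 0 = y0 ∧ ∀ n, RunsHMatrix (H n) T y) ∧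
        (∀ y : ℕ → X, (∀ n, RunsHMatrix (H n) T y) →
          ∀ n, y n = (rdoLowMemory p T (y 0) n).1) ∧
        -- rate of convergence
        (Nonexpansive T → ∀ ystar : X, T ystar = ystar →
          ∀ y : ℕ → X, (∀ n, RunsHMatrix (H n) T y) →
            ∀ k : ℕ, ‖y (k * p) - T (y (k * p))‖ ^ 2
              ≤ 4 * ‖y 0 - ystar‖ ^ 2 / ((k : ℝ) * p + 1) ^ 2) := by
  obtain ⟨b, rfl⟩ : ∃ b, p = b + 1 := ⟨p - 1, by omega⟩
  refine ⟨⟨rdoMatrix b, isRDOFamily_rdoMatrix b, fun H hH => hH.eq_rdoMatrix⟩, fun H hH => ?_⟩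
  obtain rfl := hH.eq_rdoMatrix
  refine ⟨rdoMatrix_mem_optimalHMatrices b, fun m n h => rdoMatrix_entry_of_lt b h, ?_⟩
  intro X _ _ _ T
  have hrec : ∀ y : ℕ → X, (∀ n, RunsHMatrix (rdoMatrix b n) T y) →
      RDORecurrence (b + 1) T y := fun y hy =>
    (rdoRecurrence_iff b T y).2 fun k => (hy (k + 1)).blockStep_of_rdoMatrix k (Nat.lt_succ_self k)
  -- the recurrence has at most one solution with a given starting point
  have huniq : ∀ y z : ℕ → X, y 0 = z 0 → RDORecurrence (b + 1) T y → RDORecurrence (b + 1) T z →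
      y = z := fun y z h0 hy hz => funext fun n => by
    rw [← (hy.eq_rdoLowMemory hp n).1, ← (hz.eq_rdoLowMemory hp n).1, h0]
  refine ⟨fun y => ⟨hrec y, fun hy => ?_⟩, fun y0 => ?_, fun y hy n => ?_, ?_⟩
  · obtain ⟨z, hz0, hz⟩ := exists_runs_rdoMatrix b T (y 0)
    rwa [huniq y z hz0.symm hy (hrec z hz)]
  · obtain ⟨z, hz0, hz⟩ := exists_runs_rdoMatrix b T y0
    exact ⟨z, ⟨hz0, hz⟩, fun y hy => huniq y z (hy.1.trans hz0.symm) (hrec y hy.2) (hrec z hz)⟩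
  · exact (((hrec y hy).eq_rdoLowMemory hp n).1).symm
  · intro hT ystar hs y hy k
    have := (anchorInequality_of_blockStep hT (hy k).blockStep_of_rdoMatrix).norm_sq_le hT hs
    simpa using this
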